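/- Theorem. A prophet inequality instance on $n$ elements consists of a downward-closed family $\mathcal F$ of feasible subsets with $\emptyset\in\mathcal F$, a known probability distribution on $[0,\infty)$ for the value of each element (the values are independent), and a known fixed order in which the elements arrive and reveal their values. An online algorithm (possibly randomized, with internal randomness independent of the values) accepts or rejects each element immediately and irrevocably, based only on its randomness and on the values revealed so far, so that the set of accepted elements always belongs to $\mathcal F$; its value $\mathrm{ALG}$ is the sum of the values of the accepted elements. The hindsight optimum $\mathrm{OPT}$ is the maximum total realized value of a set in $\mathcal F$. There exist integers $L=L(n)=\Theta(\log n/\log\log n)$ and absolute constants $c,C,\kappa>0$ such that for every sufficiently large $n$ there is a prophet inequality instance on $n$ elements with $$\mathbb E[\mathrm{OPT}]\ \ge\ c\,L,$$ and such that every online algorithm for this instance satisfies $$\mathbb E[\mathrm{ALG}]\ \le\ C/L\qquad\text{and}\qquad \mathbb E[\mathrm{OPT}]\ \ge\ \kappa\,L^2\cdot\mathbb E[\mathrm{ALG}],$$ i.e. no online algorithm has a competitive ratio better than $\Omega(L^2)$. -/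

import Mathlib

open MeasureTheory Filter Asymptotics
open scoped ENNReal NNReal

universe u

/-- A prophet inequality instance with `n` elements. The elements are labelled by their position in
the known, fixed arrival order, so element `i : Fin n` is the `i`-th one to arrive. -/
structure ProphetInstance (n : ℕ) where
  /-- The family of feasible sets. -/
  feasible : Set (Finset (Fin n))
  empty_feasible : ∅ ∈ feasible
  /-- Every subset of a feasible set is feasible. -/
  downward_closed : ∀ S ∈ feasible, ∀ T ⊆ S, T ∈ feasible
  /-- The (known) law of the non-negative value of each element. -/
  dist : Fin n → Measure ℝ≥0
  isProbabilityMeasure_dist : ∀ i, IsProbabilityMeasure (dist i)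

namespace ProphetInstance

variable {n : ℕ}

/-- The joint law of the values: they are independent, value `i` having law `dist i`. -/
noncomputable def valueLaw (I : ProphetInstance n) : Measure (Fin n → ℝ≥0) :=
  haveI := I.isProbabilityMeasure_dist
  Measure.pi I.dist

/-- The hindsight optimum for the realized values `v`: the maximum of the total value of a feasible
set, the objective being additive. -/
noncomputable def hindsightOpt (I : ProphetInstance n) (v : Fin n → ℝ≥0) : ℝ≥0∞ :=
  ⨆ S ∈ I.feasible, ∑ i ∈ S, (v i : ℝ≥0∞)

/-- The benchmark: the expected hindsight optimum. -/
noncomputable def expectedOpt (I : ProphetInstance n) : ℝ≥0∞ :=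
  ∫⁻ v, I.hindsightOpt v ∂I.valueLaw

end ProphetInstance

/-- A (possibly randomized) online algorithm for the instance `I`. The internal randomness is a seed
drawn from an arbitrary probability space, independently of the values. The decision on
element `i` is made immediately when it arrives and irrevocably: it is a function of the seed and of
the values of the elements `j ≤ i` only. The algorithm may depend on all the data of `I`. -/
structure OnlineAlgorithm {n : ℕ} (I : ProphetInstance n) where
  Seed : Type u
  measurableSpaceSeed : MeasurableSpace Seed
  seedLaw : Measure Seed
  isProbabilityMeasure_seedLaw : IsProbabilityMeasure seedLaw
  /-- Whether element `i` is accepted, given the seed and the values revealed so far. -/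
  accept : (i : Fin n) → Seed × ({j : Fin n // j ≤ i} → ℝ≥0) → Bool
  measurable_accept : ∀ i, Measurable (accept i)
  /-- The set of accepted elements is always feasible. As feasibility is downward closed, this
  makes the set of elements accepted so far feasible at every time. -/
  accepted_feasible : ∀ (s : Seed) (v : Fin n → ℝ≥0),
    Finset.univ.filter (fun i => accept i (s, fun j => v j.1) = true) ∈ I.feasible

namespace OnlineAlgorithm

variable {n : ℕ} {I : ProphetInstance n}

/-- The set of elements accepted on seed `s` and values `v`. -/
def accepted (A : OnlineAlgorithm.{u} I) (s : A.Seed) (v : Fin n → ℝ≥0) : Finset (Fin n) :=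
  Finset.univ.filter (fun i => A.accept i (s, fun j => v j.1) = true)

/-- The expected total value of the accepted elements, over the seed and the values. -/
noncomputable def expectedValue (A : OnlineAlgorithm.{u} I) : ℝ≥0∞ :=
  letI := A.measurableSpaceSeed
  ∫⁻ x : A.Seed × (Fin n → ℝ≥0), ∑ i ∈ A.accepted x.1 x.2, (x.2 i : ℝ≥0∞)
    ∂(A.seedLaw.prod I.valueLaw)

end OnlineAlgorithm

/-! Let `K` be a field with `q` elements, `q` of order `L ^ 2`. Take the `K`-ary tree with `L`
levels; at every node and for every polynomial of degree at most `d` over `K` put a block of `L`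
items. An item at depth `h` is worth `q ^ (-h) / L` with probability `p = L ^ (-2)` and otherwise
`0`. A feasible set picks items from one polynomial per node, where the constant term at the child
`a` is the parent's polynomial evaluated at `a`. Deepest nodes arrive first.

Hindsight sees, with probability at least one half, at every node and for every constant term a
polynomial whose whole block is active (`half_le_measure_allGood`). Choosing such polynomials from
the root downwards yields `1` per level, hence `L` in total (`le_hindsightOpt_treeInstance`).

An online algorithm works upwards. By interpolation, fixing the polynomials at `d + 1` children
fixes the parent's polynomial before the parent's items are seen. Call a node committed if it has an
accepted item or at least `d + 1` committed children. Items whose node was already committed lie in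
a forced block, so they cannot be selected by their values: their maximal values add up to at most
`L`, of which a fraction `p` is active, giving `1 / L` (`sum_determined_le`). The other accepted
items number at most one per node, at nodes with at most `d` committed children. As `d + 1` is small
compared with `q / L`, such nodes have weight at most `2`, giving `2 / L` (`sum_free_le`,
`sum_not_determined_le`). Altogether the algorithm gets at most `3 / L`. -/

/-! ### Bernoulli values and the splitting of an algorithm's reward. -/

/-- The law of `w` times a Bernoulli variable with success probability `p`. -/
noncomputable def scaledBernoulli (p w : ℝ≥0) : Measure ℝ≥0 :=
  (p : ℝ≥0∞) • Measure.dirac w + ((1 - p : ℝ≥0) : ℝ≥0∞) • Measure.dirac 0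

theorem isProbabilityMeasure_scaledBernoulli {p : ℝ≥0} (hp : p ≤ 1) (w : ℝ≥0) :
    IsProbabilityMeasure (scaledBernoulli p w) := by
  constructor
  simp only [scaledBernoulli, Measure.coe_add, Measure.coe_smul, Pi.add_apply, Pi.smul_apply,
    measure_univ, smul_eq_mul, mul_one]
  rw [← ENNReal.coe_add, add_tsub_cancel_of_le hp, ENNReal.coe_one]

theorem lintegral_scaledBernoulli (p w : ℝ≥0) :
    ∫⁻ x : ℝ≥0, (x : ℝ≥0∞) ∂scaledBernoulli p w = p * w := by
  simp only [scaledBernoulli, lintegral_add_measure, lintegral_smul_measure, lintegral_dirac,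
    ENNReal.coe_zero, smul_eq_mul, mul_zero, add_zero]

theorem ae_le_scaledBernoulli (p w : ℝ≥0) : ∀ᵐ x ∂scaledBernoulli p w, x ≤ w := by
  rw [ae_iff, scaledBernoulli]
  simp

theorem le_scaledBernoulli_singleton (p w : ℝ≥0) : (p : ℝ≥0∞) ≤ scaledBernoulli p w {w} := by
  simp [scaledBernoulli]

/-- Resampling a coordinate on which the factor `g` does not depend. -/
theorem lintegral_pi_mul_eval {ι : Type*} [Fintype ι] [DecidableEq ι] {μ : ι → Measure ℝ≥0}
    [∀ i, IsProbabilityMeasure (μ i)] (i : ι) {g : (ι → ℝ≥0) → ℝ≥0∞} (hg : Measurable g)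
    (hgi : ∀ v x, g (Function.update v i x) = g v) :
    ∫⁻ v, g v * v i ∂Measure.pi μ = ∫⁻ v, g v * ∫⁻ x : ℝ≥0, (x : ℝ≥0∞) ∂μ i ∂Measure.pi μ := by
  refine lintegral_eq_of_lmarginal_eq {i} (by fun_prop) (by fun_prop) ?_
  funext v
  simp only [lmarginal_singleton, hgi, Function.update_self]
  rw [lintegral_const_mul _ (by fun_prop)]
  simp

namespace OnlineAlgorithm

variable {n : ℕ} {I : ProphetInstance n}

theorem mem_accepted (A : OnlineAlgorithm.{u} I) (s : A.Seed) (v : Fin n → ℝ≥0) (i : Fin n) :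
    i ∈ A.accepted s v ↔ A.accept i (s, fun j => v j.1) = true := by
  simp [accepted]

/-- The online constraint enters here: decisions made before time `i` cannot depend on the value of
`i`. -/
theorem accepted_before_update (A : OnlineAlgorithm.{u} I) (s : A.Seed) (v : Fin n → ℝ≥0)
    (i : Fin n) (x : ℝ≥0) :
    (A.accepted s (Function.update v i x)).filter (· < i) = (A.accepted s v).filter (· < i) := by
  ext j
  simp only [Finset.mem_filter, mem_accepted, and_congr_left_iff]
  intro hj
  have : (fun k : {k : Fin n // k ≤ j} => Function.update v i x k.1) = fun k => v k.1 := by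
    funext k
    exact Function.update_of_ne (k.2.trans_lt hj).ne _ _
  rw [this]

theorem measurable_comp_accepted (A : OnlineAlgorithm.{u} I) {β : Type*} [MeasurableSpace β]
    (g : Finset (Fin n) → β) :
    letI := A.measurableSpaceSeed
    Measurable fun x : A.Seed × (Fin n → ℝ≥0) => g (A.accepted x.1 x.2) := by
  let _ := A.measurableSpaceSeed
  have h : Measurable fun (x : A.Seed × (Fin n → ℝ≥0)) (i : Fin n) =>
      A.accept i (x.1, fun j => x.2 j.1) :=
    measurable_pi_lambda _ fun i => (A.measurable_accept i).comp (by fun_prop)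
  have h' : Measurable fun b : Fin n → Bool => g (Finset.univ.filter fun i => b i = true) :=
    Measurable.of_discrete
  exact h'.comp h

/-- The accepted elements are split according to whether they satisfy a predicate `Q` of the
elements accepted earlier. Those which do not are charged their largest possible value, and the
decision on the others may as well be taken before they are revealed. -/
theorem expectedValue_le_add (A : OnlineAlgorithm.{u} I) {w : Fin n → ℝ≥0} {p : ℝ≥0}
    (hI : ∀ i, I.dist i = scaledBernoulli p (w i)) (Q : Fin n → Finset (Fin n) → Prop)
    [∀ i S, Decidable (Q i S)] {a b : ℝ≥0∞}
    (ha : ∀ S ∈ I.feasible, ∑ i ∈ S with ¬ Q i (S.filter (· < i)), (w i : ℝ≥0∞) ≤ a)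
    (hb : ∀ S ∈ I.feasible, ∑ i with Q i (S.filter (· < i)), (w i : ℝ≥0∞) ≤ b) :
    A.expectedValue ≤ a + p * b := by
  let _ := A.measurableSpaceSeed
  have := A.isProbabilityMeasure_seedLaw
  have := I.isProbabilityMeasure_dist
  have : IsProbabilityMeasure I.valueLaw := by unfold ProphetInstance.valueLaw; infer_instance
  have hfeas : ∀ x : A.Seed × (Fin n → ℝ≥0), A.accepted x.1 x.2 ∈ I.feasible :=
    fun x => A.accepted_feasible x.1 x.2
  let q : Fin n → A.Seed × (Fin n → ℝ≥0) → ℝ≥0∞ := fun i x =>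
    if Q i ((A.accepted x.1 x.2).filter (· < i)) then 1 else 0
  have hq : ∀ i, Measurable (q i) := fun i =>
    A.measurable_comp_accepted fun S => if Q i (S.filter (· < i)) then (1 : ℝ≥0∞) else 0
  have hle : ∀ᵐ x ∂(A.seedLaw.prod I.valueLaw), ∀ i, x.2 i ≤ w i := by
    refine ae_all_iff.2 fun i => ?_
    have h1 : ∀ᵐ v ∂I.valueLaw, v i ≤ w i := by
      have := ae_le_scaledBernoulli p (w i)
      rw [← hI i] at this
      exact (Measure.quasiMeasurePreserving_eval (μ := I.dist) i).ae this
    exact Measure.quasiMeasurePreserving_snd.ae h1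
  -- `q i` reads only decisions taken before time `i`, so the value of `i` can be replaced by its
  -- mean.
  have key : ∀ i, ∫⁻ x, q i x * x.2 i ∂(A.seedLaw.prod I.valueLaw)
      = ∫⁻ x, q i x * (p * w i) ∂(A.seedLaw.prod I.valueLaw) := by
    intro i
    have hm : Measurable fun x : A.Seed × (Fin n → ℝ≥0) => (x.2 i : ℝ≥0∞) := by fun_prop
    rw [lintegral_prod (fun x => q i x * x.2 i) ((hq i).mul hm).aemeasurable,
      lintegral_prod (fun x => q i x * (p * w i)) ((hq i).mul_const _).aemeasurable]
    refine lintegral_congr fun s => ?_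
    have := lintegral_pi_mul_eval (μ := I.dist) i (g := fun v => q i (s, v))
      ((hq i).comp measurable_prodMk_left) (fun v x => by
        simp only [q, A.accepted_before_update])
    rw [hI i, lintegral_scaledBernoulli] at this
    exact this
  calc A.expectedValue
      ≤ ∫⁻ x, (a + ∑ i, q i x * x.2 i) ∂(A.seedLaw.prod I.valueLaw) := by
        refine lintegral_mono_ae (hle.mono fun x hx => ?_)
        rw [← Finset.sum_filter_not_add_sum_filter (A.accepted x.1 x.2)
          (fun i => Q i ((A.accepted x.1 x.2).filter (· < i)))]
        refine add_le_add ((Finset.sum_le_sum fun i _ => ?_).trans (ha _ (hfeas x))) ?_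
        · exact ENNReal.coe_le_coe.2 (hx i)
        · rw [Finset.sum_filter]
          refine (Finset.sum_le_sum_of_subset (Finset.subset_univ _)).trans
            (Finset.sum_le_sum fun i _ => ?_)
          simp only [q]
          split_ifs <;> simp
    _ = a + ∑ i, ∫⁻ x, q i x * (p * w i) ∂(A.seedLaw.prod I.valueLaw) := by
        rw [lintegral_add_left measurable_const, lintegral_finsetSum]
        · simp [key]
        · intro i _
          exact (hq i).mul (by fun_prop)
    _ = a + ∫⁻ x, p * ∑ i, q i x * w i ∂(A.seedLaw.prod I.valueLaw) := by
        rw [← lintegral_finsetSum _ fun i _ => (hq i).mul_const _]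
        congr 2
        funext x
        rw [Finset.mul_sum]
        exact Finset.sum_congr rfl fun i _ => by ring
    _ ≤ a + ∫⁻ _, p * b ∂(A.seedLaw.prod I.valueLaw) := by
        gcongr with x
        refine le_trans (le_of_eq ?_) (hb _ (hfeas x))
        rw [Finset.sum_filter]
        exact Finset.sum_congr rfl fun i _ => by simp only [q]; split_ifs <;> simp
    _ = a + p * b := by simp

end OnlineAlgorithm

/-! ### Committed nodes and weights in the `K`-ary tree. -/

section Tree

variable {K : Type*}

/-- A node of the infinite `K`-ary tree (the children of `l` are the `a :: l`) is committed by a set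
`T` of nodes if it belongs to `T` or at least `d` of its children are committed. -/
inductive Committed (d : ℕ) (T : List K → Prop) : List K → Prop
  | of_mem {l : List K} (h : T l) : Committed d T l
  | of_children {l : List K} (s : Finset K) (hs : d ≤ s.card)
      (h : ∀ a ∈ s, Committed d T (a :: l)) : Committed d T l

/-- Commitment of `l` is witnessed at `l` and deeper only, so it is already settled when all nodes
there have been processed. -/
theorem Committed.of_subset_below {d : ℕ} {T T' : List K → Prop} {l : List K}
    (h : Committed d T l) (hT : ∀ l', l.length ≤ l'.length → T l' → T' l') :
    Committed d T' l := by
  induction h with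
  | of_mem h => exact .of_mem (hT _ le_rfl h)
  | of_children s hs _ ih =>
    exact .of_children s hs fun a ha => ih a ha fun l' hl' =>
      hT l' (by simp only [List.length_cons] at hl'; omega)

variable [Fintype K] [DecidableEq K]

/-- The nodes at distance less than `k` below the node `l`. -/
def nodesBelow : ℕ → List K → Finset (List K)
  | 0, _ => ∅
  | k + 1, l => insert l (Finset.univ.biUnion fun a => nodesBelow k (a :: l))

theorem suffix_of_mem_nodesBelow {k : ℕ} {l l' : List K} (h : l' ∈ nodesBelow k l) :
    l <:+ l' := by
  induction k generalizing l with
  | zero => simp [nodesBelow] at h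
  | succ k ih =>
    simp only [nodesBelow, Finset.mem_insert, Finset.mem_biUnion, Finset.mem_univ, true_and] at h
    rcases h with rfl | ⟨a, ha⟩
    · exact List.suffix_rfl
    · exact (List.suffix_cons a l).trans (ih ha)

theorem sum_nodesBelow_succ {M : Type*} [AddCommMonoid M] (f : List K → M) (k : ℕ) (l : List K) :
    ∑ x ∈ nodesBelow (k + 1) l, f x = f l + ∑ a, ∑ x ∈ nodesBelow k (a :: l), f x := by
  rw [nodesBelow, Finset.sum_insert, Finset.sum_biUnion]
  · intro a _ b _ hab
    rw [Function.onFun, Finset.disjoint_left]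
    intro x hx hx'
    have := (List.suffix_of_suffix_length_le (suffix_of_mem_nodesBelow hx)
      (suffix_of_mem_nodesBelow hx') le_rfl).eq_of_length rfl
    exact hab (by simpa using this)
  · simp only [Finset.mem_biUnion, Finset.mem_univ, true_and, not_exists]
    intro a ha
    have := (suffix_of_mem_nodesBelow ha).length_le
    simp at this

/-- Each of the `k` levels carries the same weight as the top node `l`. -/
theorem sum_nodesBelow_inv_pow [Nonempty K] (k : ℕ) (l : List K) :
    ∑ x ∈ nodesBelow k l, ((Fintype.card K : ℝ≥0) ^ x.length)⁻¹
      = k * ((Fintype.card K : ℝ≥0) ^ l.length)⁻¹ := by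
  have hq : (Fintype.card K : ℝ≥0) ≠ 0 := by simp
  induction k generalizing l with
  | zero => simp [nodesBelow]
  | succ k ih =>
    rw [sum_nodesBelow_succ]
    simp only [ih, List.length_cons, Finset.sum_const, Finset.card_univ, nsmul_eq_mul, pow_succ]
    push_cast
    field_simp
    ring

theorem card_nodesBelow_le (hK : 2 ≤ Fintype.card K) (k : ℕ) (l : List K) :
    (nodesBelow k l).card + 1 ≤ Fintype.card K ^ k := by
  induction k generalizing l with
  | zero => simp [nodesBelow]
  | succ k ih =>
    have h : ∑ a : K, ((nodesBelow k (a :: l)).card + 1) ≤ ∑ _a : K, Fintype.card K ^ k :=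
      Finset.sum_le_sum fun a _ => ih _
    simp only [Finset.sum_add_distrib, Finset.sum_const, Finset.card_univ, smul_eq_mul,
      mul_one] at h
    have := sum_nodesBelow_succ (fun _ => 1) k l
    simp only [← Finset.card_eq_sum_ones] at this
    rw [this, pow_succ']
    omega

open Classical in
/-- The nodes of `T` with fewer than `d` committed children have small total weight. -/
theorem sum_free_le {d L : ℕ} (hd : 2 * d * L ≤ Fintype.card K) (hd0 : 0 < d) (T : List K → Prop)
    (k : ℕ) (hk : k ≤ L) (l : List K) :
    (∑ x ∈ nodesBelow k l,
      if T x ∧ (Finset.univ.filter fun a => Committed d T (a :: x)).card < d then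
        ((Fintype.card K : ℝ) ^ x.length)⁻¹ else 0)
      ≤ (if Committed d T l then (2 : ℝ) else 2 * d * k / Fintype.card K)
        * ((Fintype.card K : ℝ) ^ l.length)⁻¹ := by
  -- The bound is a two-valued potential: `2` at a committed node, the small `2 * d * k / q ≤ 1` at
  -- any other; `k` counts the levels left.
  induction k generalizing l with
  | zero =>
    simp only [nodesBelow, Finset.sum_empty]
    positivity
  | succ k ih =>
    rw [sum_nodesBelow_succ]
    set q : ℝ := (Fintype.card K : ℝ) with hq
    have hdL : (2 * d * (k + 1) : ℝ) ≤ q := by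
      have : 2 * d * (k + 1) ≤ Fintype.card K := le_trans (by gcongr) hd
      rw [hq]; exact_mod_cast this
    have hd' : (1 : ℝ) ≤ d := by exact_mod_cast hd0
    have hk' : (0 : ℝ) ≤ k := by positivity
    have hqpos : 0 < q := by nlinarith
    set P := (q ^ l.length)⁻¹ with hP
    have hPpos : 0 < P := by positivity
    set m := (Finset.univ.filter fun a => Committed d T (a :: l)).card with hm
    have hchild : ∀ a : K, (if Committed d T (a :: l) then (2 : ℝ) else 2 * d * k / q)
        * (q ^ (a :: l).length)⁻¹
        = (if Committed d T (a :: l) then 2 else 2 * d * k / q) * (P / q) := by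
      intro a
      rw [List.length_cons, pow_succ, mul_inv, hP]; rfl
    have hratio : 2 * d * k / q ≤ 1 := by
      rw [div_le_one hqpos]; nlinarith
    have hsum : ∑ a : K, (if Committed d T (a :: l) then (2 : ℝ) else 2 * d * k / q)
        ≤ min (2 * q) (2 * m + 2 * d * k) := by
      refine le_min ?_ ?_
      · calc _ ≤ ∑ _a : K, (2 : ℝ) := by
              gcongr with a; split_ifs <;> linarith
          _ = 2 * q := by simp [hq, mul_comm]
      · calc _ ≤ ∑ a : K, ((if Committed d T (a :: l) then (2 : ℝ) else 0) + 2 * d * k / q) := by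
              gcongr with a
              have : 0 ≤ 2 * d * k / q := by positivity
              split_ifs <;> linarith
          _ = 2 * m + 2 * d * k := by
              rw [Finset.sum_add_distrib, ← Finset.sum_filter]
              simp only [Finset.sum_const, Finset.card_univ, nsmul_eq_mul, ← hq, ← hm]
              field_simp
    have htot : ∑ a, ∑ x ∈ nodesBelow k (a :: l),
        (if T x ∧ (Finset.univ.filter fun a => Committed d T (a :: x)).card < d then
          (q ^ x.length)⁻¹ else 0) ≤ min (2 * q) (2 * m + 2 * d * k) * (P / q) := by
      refine (Finset.sum_le_sum fun a _ => (ih (by omega) (a :: l)).trans_eq (hchild a)).trans ?_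
      rw [← Finset.sum_mul]
      gcongr
    refine (add_le_add_right htot _).trans ?_
    -- With at least `d` committed children, `l` contributes nothing itself, and averaging the
    -- children's bounds gives at most `2`.
    by_cases hc : d ≤ m
    · rw [if_neg (by intro h; omega), if_pos (Committed.of_children _ hc (by simp)), zero_add]
      calc _ ≤ (2 * q) * (P / q) := by gcongr; exact min_le_left _ _
        _ = 2 * P := by field_simp
    -- With fewer than `d` committed children, the subtrees give at most `2 * d * (k + 1) / q ≤ 1`.
    -- The node itself adds `1` only if it lies in `T`; then it is committed and `2` is allowed.
    · have hmd : (m : ℝ) + 1 ≤ d := by exact_mod_cast not_le.1 hc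
      have h1 : min (2 * q) (2 * m + 2 * d * k) * (P / q) ≤ (2 * d * (k + 1) / q) * P := by
        calc _ ≤ (2 * d + 2 * d * k) * (P / q) := by
              gcongr
              exact (min_le_right _ _).trans (by linarith)
          _ = _ := by ring
      have h2 : 2 * d * (k + 1) / q ≤ 1 := by rw [div_le_one hqpos]; exact hdL
      by_cases hT : T l
      · rw [if_pos ⟨hT, not_le.1 hc⟩, if_pos (Committed.of_mem hT)]
        nlinarith
      · rw [if_neg (fun h => hT h.1)]
        push_cast
        split_ifs
        · nlinarith
        · linarith

end Tree

/-! ### Interpolation. -/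

/-- The value at `x` of the polynomial with coefficients `c`. -/
def evalCoeff {K : Type*} [Field K] {d : ℕ} (c : Fin d → K) (x : K) : K := ∑ i, c i * x ^ (i : ℕ)

/-- The difference has degree less than `d` and at least `d` roots. -/
theorem eq_of_evalCoeff_eq {K : Type*} [Field K] {d : ℕ} {c c' : Fin d → K} (s : Finset K)
    (hs : d ≤ s.card) (h : ∀ a ∈ s, evalCoeff c a = evalCoeff c' a) : c = c' := by
  classical
  let f : Polynomial K := ∑ i : Fin d, Polynomial.monomial (i : ℕ) (c i - c' i)
  have hf : f = 0 := by
    refine Polynomial.eq_zero_of_degree_lt_of_eval_finset_eq_zero s ?_ fun a ha => ?_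
    · refine lt_of_lt_of_le ((Polynomial.degree_sum_le _ _).trans_lt ?_) (Nat.cast_le.2 hs)
      refine (Finset.sup_lt_iff (WithBot.bot_lt_coe d)).2 fun i _ => ?_
      exact (Polynomial.degree_monomial_le _ _).trans_lt (Nat.cast_lt.2 i.2)
    · have := h a ha
      simp only [f, Polynomial.eval_finsetSum, Polynomial.eval_monomial, sub_mul,
        Finset.sum_sub_distrib]
      exact sub_eq_zero.2 this
  funext i
  have := congrArg (fun g => Polynomial.coeff g i) hf
  simp only [f, Polynomial.finsetSum_coeff, Polynomial.coeff_monomial, Polynomial.coeff_zero,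
    Fin.val_inj, Finset.sum_ite_eq', Finset.mem_univ, if_true] at this
  exact sub_eq_zero.1 this

/-! ### Failure of many independent blocks. -/

/-- Events that depend on disjoint blocks of an independent family are independent; blocks are added
one at a time. -/
theorem ProbabilityTheory.iIndep.measure_biInter_compl {Ω ι J : Type*} [DecidableEq J]
    {m : ι → MeasurableSpace Ω} {mΩ : MeasurableSpace Ω} {μ : Measure Ω} [IsProbabilityMeasure μ]
    (hle : ∀ i, m i ≤ mΩ) (h : ProbabilityTheory.iIndep m μ) {a : ι → Set Ω}
    (ha : ∀ i, MeasurableSet[m i] (a i)) (B : J → Finset ι)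
    (hB : ∀ f f', f ≠ f' → Disjoint (B f) (B f')) (T : Finset J) :
    μ (⋂ f ∈ T, (⋂ i ∈ B f, a i)ᶜ) = ∏ f ∈ T, (1 - ∏ i ∈ B f, μ (a i)) := by
  induction T using Finset.induction_on with
  | empty => simp
  | insert f T hf ih =>
    have hmeas : ∀ (S : Set ι) (g : J), (∀ i ∈ B g, i ∈ S) →
        MeasurableSet[⨆ i ∈ S, m i] (⋂ i ∈ B g, a i)ᶜ := fun S g hS =>
      (Finset.measurableSet_biInter _ fun i hi =>
        le_iSup₂ (f := fun i (_ : i ∈ S) => m i) i (hS i hi) _ (ha i)).compl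
    have hdisj : Disjoint {i | i ∈ B f} {i | ∃ g ∈ T, i ∈ B g} := by
      rw [Set.disjoint_left]
      rintro i hi ⟨g, hg, hig⟩
      exact Finset.disjoint_left.1 (hB f g (by rintro rfl; exact hf hg)) hi hig
    have hind := (ProbabilityTheory.Indep_iff _ _ μ).1
      (ProbabilityTheory.indep_iSup_of_disjoint hle h hdisj) _ _
      (hmeas {i | i ∈ B f} f fun i hi => hi)
      (Finset.measurableSet_biInter T fun g hg =>
        hmeas {i | ∃ g ∈ T, i ∈ B g} g fun i hi => ⟨g, hg, hi⟩)
    rw [Finset.set_biInter_insert, hind, ih, Finset.prod_insert hf,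
      prob_compl_eq_one_sub (Finset.measurableSet_biInter _ fun i _ => hle i _ (ha i)),
      h.meas_biInter fun i _ => ha i]

/-- If each coordinate falls into `A i` with probability at least `p`, it is unlikely that none of
many disjoint blocks of `k` coordinates succeeds entirely. -/
theorem measure_pi_forall_block_fails_le {ι J : Type*} [Fintype ι] [DecidableEq J]
    {μ : ι → Measure ℝ≥0} [∀ i, IsProbabilityMeasure (μ i)] {A : ι → Set ℝ≥0}
    (hA : ∀ i, MeasurableSet (A i)) {p : ℝ≥0∞} {k : ℕ} (B : J → Finset ι)
    (hp : ∀ f, ∀ i ∈ B f, p ≤ μ i (A i))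
    (hB : ∀ f f', f ≠ f' → Disjoint (B f) (B f')) (hk : ∀ f, (B f).card = k) (T : Finset J) :
    Measure.pi μ {v | ∀ f ∈ T, ¬ ∀ i ∈ B f, v i ∈ A i} ≤ (1 - p ^ k) ^ T.card := by
  have hind : ProbabilityTheory.iIndepFun (fun i (v : ι → ℝ≥0) => v i) (Measure.pi μ) :=
    ProbabilityTheory.iIndepFun_pi (X := fun _ x => x) fun i => aemeasurable_id
  have h := ProbabilityTheory.iIndep.measure_biInter_compl
    (fun i => (measurable_pi_apply i).comap_le) hind.iIndep
    (a := fun i => (fun v : ι → ℝ≥0 => v i) ⁻¹' A i) (fun i => ⟨A i, hA i, rfl⟩) B hB T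
  have heq : {v : ι → ℝ≥0 | ∀ f ∈ T, ¬ ∀ i ∈ B f, v i ∈ A i}
      = ⋂ f ∈ T, (⋂ i ∈ B f, (fun v : ι → ℝ≥0 => v i) ⁻¹' A i)ᶜ := by
    ext v; simp
  rw [heq, h, ← Finset.prod_const]
  refine Finset.prod_le_prod' fun f _ => tsub_le_tsub_left ?_ 1
  rw [← hk f, ← Finset.prod_const]
  refine Finset.prod_le_prod' fun i hi => ?_
  rw [(measurePreserving_eval μ i).measure_preimage (hA i).nullMeasurableSet]
  exact hp f i hi

/-- By Bernoulli `N * x ≤ (1 + x) ^ N`, and `(1 - x) * (1 + x) ≤ 1`. So `N` independent trials all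
fail with probability at most `1 / (N * x)`, which is strong enough here without an exponential
bound. -/
theorem ENNReal.one_sub_pow_mul_le_one {x : ℝ≥0∞} (N : ℕ) (hx : x ≤ 1) :
    (1 - x) ^ N * (N * x) ≤ 1 := by
  lift x to ℝ≥0 using ne_top_of_le_ne_top ENNReal.one_ne_top hx
  have hx' : x ≤ 1 := by exact_mod_cast hx
  suffices h : (1 - x) ^ N * (N * x) ≤ 1 by exact_mod_cast h
  rw [← NNReal.coe_le_coe]
  push_cast [hx']
  have h0 : (0 : ℝ) ≤ x := x.2
  have h1 : (x : ℝ) ≤ 1 := by exact_mod_cast hx'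
  have h2 : (N : ℝ) * x ≤ (1 + (x : ℝ)) ^ N :=
    le_trans (by linarith) (one_add_mul_le_pow (by linarith) N)
  calc (1 - (x : ℝ)) ^ N * (N * x) ≤ (1 - x) ^ N * (1 + x) ^ N := by gcongr
    _ = (1 - x ^ 2) ^ N := by rw [← mul_pow]; ring
    _ ≤ 1 := pow_le_one₀ (by nlinarith) (by nlinarith)

/-! ### Consistent assignments of polynomials. -/

/-- An assignment of polynomials of degree at most `d` to the nodes of the `K`-ary tree is
consistent if the value at `0` of the polynomial of the child `a :: l` of `l` is the value at `a` of
the polynomial of `l`. -/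
def Consistent {K : Type*} [Field K] {d : ℕ} (F : List K → Fin (d + 1) → K) : Prop :=
  ∀ l a, F (a :: l) 0 = evalCoeff (F l) a

/-- The constant terms of `d + 1` committed children are values of the parent's polynomial at
distinct points, so agreement propagates upwards by interpolation. -/
theorem Consistent.eq_of_committed {K : Type*} [Field K] {d : ℕ} {F F' : List K → Fin (d + 1) → K}
    (hF : Consistent F) (hF' : Consistent F') {T : List K → Prop}
    (hT : ∀ l, T l → F l = F' l) {l : List K}
    (h : Committed (d + 1) T l) : F l = F' l := by
  induction h with
  | of_mem h => exact hT _ h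
  | of_children s hs _ ih =>
    refine eq_of_evalCoeff_eq s hs fun a ha => ?_
    rw [← hF, ← hF', ih a ha]

theorem card_filter_zero_coeff {K : Type*} [Fintype K] [DecidableEq K] {d : ℕ} (a : K) :
    (Finset.univ.filter fun c : Fin (d + 1) → K => c 0 = a).card = Fintype.card K ^ d := by
  rw [← Fintype.card_fin d, ← Fintype.card_fun, Fintype.card_fin, ← Finset.card_univ]
  refine (Finset.card_bij (fun (c : Fin d → K) _ => (Fin.cons a c : Fin (d + 1) → K)) ?_ ?_ ?_).symm
  · simp
  · intro c _ c' _ h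
    exact (Fin.cons_injective2 h).2
  · intro c hc
    refine ⟨Fin.tail c, Finset.mem_univ _, ?_⟩
    rw [← (Finset.mem_filter.1 hc).2, Fin.cons_self_tail]

/-! ### The hard instance, its online upper bound and its hindsight lower bound. -/

section Instance

variable {K : Type*} [Field K] [Fintype K] [DecidableEq K]

variable (K) in
/-- The items: for each node of depth less than `L` and each polynomial of degree at most `d` there
is a block of `L` of them. -/
abbrev TreeItem (d L : ℕ) : Type _ := nodesBelow L ([] : List K) × (Fin (d + 1) → K) × Fin L

/-- The largest value of an item of a node, such that all blocks of a consistent assignment on one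
level have total value `1`. -/
noncomputable def itemWeight (L : ℕ) (l : List K) : ℝ≥0 :=
  ((Fintype.card K : ℝ≥0) ^ l.length)⁻¹ * (L : ℝ≥0)⁻¹

theorem sum_itemWeight {L : ℕ} (hL : L ≠ 0) :
    ∑ x : nodesBelow L ([] : List K) × Fin L, itemWeight L x.1.1 = L := by
  have hL' : (L : ℝ≥0) ≠ 0 := by exact_mod_cast hL
  rw [Fintype.sum_prod_type]
  simp only [itemWeight, Finset.sum_const, Finset.card_univ, Fintype.card_fin, nsmul_eq_mul]
  rw [Finset.sum_coe_sort (nodesBelow L ([] : List K))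
    (fun l => (L : ℝ≥0) * (((Fintype.card K : ℝ≥0) ^ l.length)⁻¹ * (L : ℝ≥0)⁻¹))]
  rw [Finset.sum_congr rfl fun l _ => mul_left_comm _ _ _, ← Finset.sum_mul,
    sum_nodesBelow_inv_pow, mul_inv_cancel₀ hL']
  simp

variable {d L n : ℕ}

/-- The instance in which the item `e` arrives at time `σ e` and the feasible sets are those
contained in the blocks chosen by a consistent assignment. -/
noncomputable def treeInstance (σ : TreeItem K d L → Fin n) {p : ℝ≥0} (hp : p ≤ 1) :
    ProphetInstance n where
  feasible := {S | ∃ F : List K → Fin (d + 1) → K, Consistent F ∧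
    ∀ i ∈ S, ∃ e, σ e = i ∧ e.2.1 = F e.1.1}
  empty_feasible := by
    refine ⟨fun _ _ => 0, fun l a => ?_, by simp⟩
    simp [evalCoeff]
  downward_closed := by
    rintro S ⟨F, hF, h⟩ T hT
    exact ⟨F, hF, fun i hi => h i (hT hi)⟩
  -- Positions not hit by `σ` are padding: they have weight `0` and belong to no feasible set.
  dist i := scaledBernoulli p (Function.extend σ (fun e => itemWeight L e.1.1) 0 i)
  isProbabilityMeasure_dist _ := isProbabilityMeasure_scaledBernoulli hp _

variable {σ : TreeItem K d L → Fin n} {p : ℝ≥0} {hp : p ≤ 1}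

/-- The node `l` has an item in `S`. -/
def Touched (σ : TreeItem K d L → Fin n) (S : Finset (Fin n)) (l : List K) : Prop :=
  ∃ e, σ e ∈ S ∧ e.1.1 = l

theorem exists_consistent_of_feasible (hσ : Function.Injective σ) {S : Finset (Fin n)}
    (hS : S ∈ (treeInstance σ hp).feasible) :
    ∃ F : List K → Fin (d + 1) → K, Consistent F ∧ ∀ e, σ e ∈ S → e.2.1 = F e.1.1 := by
  obtain ⟨F, hF, h⟩ := hS
  refine ⟨F, hF, fun e he => ?_⟩
  obtain ⟨e', he', h'⟩ := h _ he
  rwa [← hσ he']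

/-- The item `σ e` extends `S` and `S` has already determined the polynomial of its node. -/
def Determined (σ : TreeItem K d L → Fin n) (hp : p ≤ 1) (i : Fin n) (S : Finset (Fin n)) : Prop :=
  ∃ e, σ e = i ∧ Committed (d + 1) (Touched σ S) e.1.1 ∧
    insert i S ∈ (treeInstance σ hp).feasible

-- A committed node admits only one polynomial, so the determined items inject into pairs of a node
-- and a slot, whose total weight is `L`. All determined items are counted, whether accepted or not.
open Classical in
theorem sum_determined_le (hσ : Function.Injective σ) (hL : L ≠ 0) (S : Finset (Fin n)) :
    ∑ i with Determined σ hp i (S.filter (· < i)),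
      Function.extend σ (fun e => itemWeight L e.1.1) 0 i ≤ L := by
  set E : Finset (TreeItem K d L) :=
    Finset.univ.filter fun e => Determined σ hp (σ e) (S.filter (· < σ e)) with hE
  have h1 : (Finset.univ.filter fun i => Determined σ hp i (S.filter (· < i))) = E.image σ := by
    ext i
    simp only [hE, Finset.mem_filter, Finset.mem_univ, true_and, Finset.mem_image]
    refine ⟨fun h => ?_, ?_⟩
    · obtain ⟨e, he, -⟩ := id h
      subst he
      exact ⟨e, h, rfl⟩
    · rintro ⟨e, h, rfl⟩
      exact h
  have key : ∀ e ∈ E, ∀ e' ∈ E, σ e ≤ σ e' → (e.1, e.2.2) = (e'.1, e'.2.2) → e = e' := by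
    rintro ⟨v, c, j⟩ he ⟨v', c', j'⟩ he' hlt heq
    obtain ⟨rfl, rfl⟩ := Prod.mk.inj heq
    obtain ⟨e₁, he₁, hc, hf⟩ := (Finset.mem_filter.1 he).2
    obtain ⟨e₂, -, -, hf'⟩ := (Finset.mem_filter.1 he').2
    obtain rfl := hσ he₁
    obtain ⟨F, hF, h⟩ := exists_consistent_of_feasible hσ hf
    obtain ⟨F', hF', h'⟩ := exists_consistent_of_feasible hσ hf'
    have hcc := h _ (Finset.mem_insert_self _ _)
    have hcc' := h' _ (Finset.mem_insert_self _ _)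
    -- What was accepted before the earlier item was also accepted before the later one, so both
    -- assignments agree on every node touched at the earlier time.
    have hFF : F v.1 = F' v.1 := by
      refine hF.eq_of_committed hF' ?_ hc
      rintro l ⟨e, he, rfl⟩
      rw [← h e (Finset.mem_insert_of_mem he), ← h' e (Finset.mem_insert_of_mem ?_)]
      rw [Finset.mem_filter] at he ⊢
      exact ⟨he.1, he.2.trans_le hlt⟩
    simp only at hcc hcc'
    rw [hcc, hcc', hFF]
  rw [h1, Finset.sum_image hσ.injOn]
  simp only [hσ.extend_apply]
  have hinj : Set.InjOn (fun e : TreeItem K d L => (e.1, e.2.2)) E := by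
    intro e he e' he' heq
    rcases le_total (σ e) (σ e') with h | h
    · exact key e he e' he' h heq
    · exact (key e' he' e he h heq.symm).symm
  rw [← Finset.sum_image (f := fun x : nodesBelow L ([] : List K) × Fin L => itemWeight L x.1.1)
    hinj]
  exact (Finset.sum_le_sum_of_subset (Finset.subset_univ _)).trans_eq (sum_itemWeight hL)

-- An accepted item that is not determined is the first one accepted at its node, and that node has
-- at most `d` committed children. So the weight of these nodes is bounded by `sum_free_le`, with
-- the factor `1 / L` coming from taking one item of the `L` in a block.
open Classical in
theorem sum_not_determined_le (hσ : Function.Injective σ)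
    (hord : ∀ e e', e'.1.1.length < e.1.1.length → σ e < σ e')
    (hK : 2 * (d + 1) * L ≤ Fintype.card K) {S : Finset (Fin n)}
    (hS : S ∈ (treeInstance σ hp).feasible) :
    ∑ i ∈ S with ¬ Determined σ hp i (S.filter (· < i)),
      Function.extend σ (fun e => itemWeight L e.1.1) 0 i ≤ 2 * (L : ℝ≥0)⁻¹ := by
  set E : Finset (TreeItem K d L) := Finset.univ.filter fun e =>
    σ e ∈ S ∧ ¬ Determined σ hp (σ e) (S.filter (· < σ e)) with hE
  have h1 : (S.filter fun i => ¬ Determined σ hp i (S.filter (· < i))) = E.image σ := by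
    ext i
    simp only [hE, Finset.mem_filter, Finset.mem_univ, true_and, Finset.mem_image]
    refine ⟨fun h => ?_, ?_⟩
    · obtain ⟨F, -, hF⟩ := id hS
      obtain ⟨e, he, -⟩ := hF i h.1
      subst he
      exact ⟨e, h, rfl⟩
    · rintro ⟨e, h, rfl⟩
      exact h
  have hnc : ∀ e ∈ E, ¬ Committed (d + 1) (Touched σ (S.filter (· < σ e))) e.1.1 := by
    intro e he hc
    have he' := (Finset.mem_filter.1 he).2
    refine he'.2 ⟨e, rfl, hc, (treeInstance σ hp).downward_closed S hS _ ?_⟩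
    exact Finset.insert_subset he'.1 (Finset.filter_subset _ _)
  have key : ∀ e ∈ E, ∀ e' ∈ E, σ e ≤ σ e' → e.1.1 = e'.1.1 → e = e' := by
    intro e he e' he' hle heq
    by_contra hne
    refine hnc e' he' (.of_mem ⟨e, Finset.mem_filter.2 ⟨(Finset.mem_filter.1 he).2.1, ?_⟩, heq⟩)
    exact lt_of_le_of_ne hle fun h => hne (hσ h)
  have hinj : Set.InjOn (fun e : TreeItem K d L => e.1.1) E := by
    intro e he e' he' heq
    rcases le_total (σ e) (σ e') with h | h
    · exact key e he e' he' h heq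
    · exact (key e' he' e he h heq.symm).symm
  have hsub : E.image (fun e => e.1.1) ⊆ (nodesBelow L []).filter fun l => Touched σ S l ∧
      (Finset.univ.filter fun a => Committed (d + 1) (Touched σ S) (a :: l)).card < d + 1 := by
    intro l hl
    obtain ⟨e, he, rfl⟩ := Finset.mem_image.1 hl
    refine Finset.mem_filter.2 ⟨e.1.2, ⟨e, (Finset.mem_filter.1 he).2.1, rfl⟩, ?_⟩
    by_contra hcard
    -- Deeper items arrive earlier, so whatever commits a child of this node was accepted before
    -- `e`.
    refine hnc e he (.of_children _ (not_lt.1 hcard) fun a ha => ?_)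
    refine (Finset.mem_filter.1 ha).2.of_subset_below ?_
    rintro l' hl' ⟨e', he', rfl⟩
    refine ⟨e', Finset.mem_filter.2 ⟨he', hord _ _ ?_⟩, rfl⟩
    simp only [List.length_cons] at hl'
    omega
  rw [h1, Finset.sum_image hσ.injOn]
  simp only [hσ.extend_apply]
  rw [← Finset.sum_image (f := fun l : List K => itemWeight L l) hinj]
  refine (Finset.sum_le_sum_of_subset hsub).trans ?_
  simp only [itemWeight]
  rw [← Finset.sum_mul]
  gcongr
  have h := sum_free_le hK d.succ_pos (Touched σ S) L le_rfl []
  rw [← NNReal.coe_le_coe, NNReal.coe_sum, Finset.sum_filter]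
  push_cast
  refine h.trans ?_
  simp only [List.length_nil, pow_zero, inv_one, mul_one]
  split_ifs
  · rfl
  · refine (div_le_one_of_le₀ ?_ (by positivity)).trans one_le_two
    exact_mod_cast hK

theorem expectedValue_treeInstance_le (hσ : Function.Injective σ)
    (hord : ∀ e e', e'.1.1.length < e.1.1.length → σ e < σ e')
    (hK : 2 * (d + 1) * L ≤ Fintype.card K) (hL : L ≠ 0)
    (A : OnlineAlgorithm.{u} (treeInstance σ hp)) :
    A.expectedValue ≤ ((2 * (L : ℝ≥0)⁻¹ + p * L : ℝ≥0) : ℝ≥0∞) := by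
  classical
  push_cast
  refine A.expectedValue_le_add (fun i => rfl) (Determined σ hp) (fun S hS => ?_) (fun S _ => ?_)
  · rw [← ENNReal.ofNNReal_finsetSum, ← ENNReal.coe_ofNat, ← ENNReal.coe_mul, ENNReal.coe_le_coe]
    exact sum_not_determined_le hσ hord hK hS
  · exact_mod_cast sum_determined_le hσ hL S

/-- The block of the polynomial `c` at the node `l`. -/
def treeBlock (σ : TreeItem K d L → Fin n) (l : nodesBelow L ([] : List K)) (c : Fin (d + 1) → K) :
    Finset (Fin n) :=
  Finset.univ.image fun j => σ (l, c, j)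

/-- For each node and each prescribed value at `0` there is a polynomial all items of whose block
have their largest value. -/
def AllGood (σ : TreeItem K d L → Fin n) (v : Fin n → ℝ≥0) : Prop :=
  ∀ (l : nodesBelow L ([] : List K)) (a : K), ∃ c : Fin (d + 1) → K, c 0 = a ∧
    ∀ i ∈ treeBlock σ l c, v i ∈ ({Function.extend σ (fun e => itemWeight L e.1.1) 0 i} : Set ℝ≥0)

theorem le_hindsightOpt_treeInstance (hσ : Function.Injective σ) (hL : L ≠ 0) {v : Fin n → ℝ≥0}
    (hv : AllGood σ v) : (L : ℝ≥0∞) ≤ (treeInstance σ hp).hindsightOpt v := by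
  classical
  have hv' : ∀ (l : List K) (a : K), ∃ c : Fin (d + 1) → K, c 0 = a ∧
      ∀ (hl : l ∈ nodesBelow L ([] : List K)) (j : Fin L),
        v (σ (⟨l, hl⟩, c, j)) = itemWeight L l := by
    intro l a
    by_cases hl : l ∈ nodesBelow L ([] : List K)
    · obtain ⟨c, hc, h⟩ := hv ⟨l, hl⟩ a
      refine ⟨c, hc, fun _ j => ?_⟩
      have := h (σ (⟨l, hl⟩, c, j)) (Finset.mem_image_of_mem _ (Finset.mem_univ j))
      rwa [Set.mem_singleton_iff, hσ.extend_apply] at this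
    -- Consistency is required on the infinite tree, so nodes without items get any polynomial with
    -- the right constant term.
    · exact ⟨fun _ => a, rfl, fun h => absurd h hl⟩
  choose c hc0 hc using hv'
  -- Choose from the root downwards: the parent's polynomial prescribes the child's constant term.
  -- The root's constant term `0` is arbitrary.
  let F : List K → Fin (d + 1) → K := fun l =>
    List.rec (c [] 0) (fun a l f => c (a :: l) (evalCoeff f a)) l
  have hF : Consistent F := fun l a => hc0 _ _
  have hFv : ∀ (x : nodesBelow L ([] : List K) × Fin L),
      v (σ (x.1, F x.1.1, x.2)) = itemWeight L x.1.1 := by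
    rintro ⟨⟨l, hl⟩, j⟩
    cases l with
    | nil => exact hc _ _ hl j
    | cons a l => exact hc _ _ hl j
  have hinj : Function.Injective
      fun x : nodesBelow L ([] : List K) × Fin L => σ (x.1, F x.1.1, x.2) := by
    intro x y hxy
    have h : (x.1, F x.1.1, x.2) = (y.1, F y.1.1, y.2) := hσ hxy
    obtain ⟨h1, h2⟩ := Prod.mk.inj h
    exact Prod.ext h1 (Prod.mk.inj h2).2
  calc (L : ℝ≥0∞)
      = ((∑ x : nodesBelow L ([] : List K) × Fin L, itemWeight L x.1.1 : ℝ≥0) : ℝ≥0∞) := by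
        rw [sum_itemWeight hL]; simp
    _ = ∑ i ∈ Finset.univ.image
          (fun x : nodesBelow L ([] : List K) × Fin L => σ (x.1, F x.1.1, x.2)),
          (v i : ℝ≥0∞) := by
        rw [Finset.sum_image hinj.injOn]
        push_cast
        exact Finset.sum_congr rfl fun x _ => by rw [hFv]
    _ ≤ _ := by
        refine le_iSup₂_of_le (f := fun S (_ : S ∈ (treeInstance σ hp).feasible) =>
          ∑ i ∈ S, (v i : ℝ≥0∞)) _ ⟨F, hF, fun i hi => ?_⟩ le_rfl
        obtain ⟨x, -, rfl⟩ := Finset.mem_image.1 hi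
        exact ⟨_, rfl, rfl⟩

/-- A union bound over at most `q ^ (L + 1)` pairs of a node and a constant term. Each pair leaves
`q ^ d` polynomials with disjoint blocks, and each block is fully active with probability at least
`p ^ L`. -/
theorem half_le_measure_allGood (hσ : Function.Injective σ)
    (hcount : (2 : ℝ≥0) * Fintype.card K ^ (L + 1) ≤ Fintype.card K ^ d * p ^ L) :
    (2 : ℝ≥0∞)⁻¹ ≤ (treeInstance σ hp).valueLaw {v | AllGood σ v} := by
  have hK : 2 ≤ Fintype.card K := Fintype.one_lt_card
  let I := treeInstance σ hp
  have := I.isProbabilityMeasure_dist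
  have : IsProbabilityMeasure I.valueLaw := by unfold ProphetInstance.valueLaw; infer_instance
  let bad : nodesBelow L ([] : List K) × K → Set (Fin n → ℝ≥0) := fun x =>
    {v | ∀ c ∈ Finset.univ.filter (fun c : Fin (d + 1) → K => c 0 = x.2),
      ¬ ∀ i ∈ treeBlock σ x.1 c,
        v i ∈ ({Function.extend σ (fun e => itemWeight L e.1.1) 0 i} : Set ℝ≥0)}
  have hbad : ∀ x, I.valueLaw (bad x) ≤ (1 - (p : ℝ≥0∞) ^ L) ^ (Fintype.card K ^ d) := by
    intro x
    rw [← card_filter_zero_coeff x.2]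
    refine measure_pi_forall_block_fails_le (μ := I.dist) (fun i => measurableSet_singleton _)
      (treeBlock σ x.1) (fun c i _ => le_scaledBernoulli_singleton _ _) ?_ ?_ _
    · intro c c' hcc
      rw [Finset.disjoint_left]
      intro i hi hi'
      obtain ⟨j, -, rfl⟩ := Finset.mem_image.1 hi
      obtain ⟨j', -, h⟩ := Finset.mem_image.1 hi'
      exact hcc (congrArg (fun e => e.2.1) (hσ h)).symm
    · intro c
      rw [treeBlock, Finset.card_image_of_injective, Finset.card_univ, Fintype.card_fin]
      intro j j' h
      exact congrArg (fun e => e.2.2) (hσ h)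
  have hcompl : {v | AllGood σ v}ᶜ ⊆ ⋃ x, bad x := by
    intro v hv
    simp only [Set.mem_compl_iff, Set.mem_ofPred_eq, AllGood, not_forall, not_exists, not_and] at hv
    obtain ⟨l, a, h⟩ := hv
    refine Set.mem_iUnion.2 ⟨(l, a), fun c hc hall => ?_⟩
    obtain ⟨i, hi, hn⟩ := h c (Finset.mem_filter.1 hc).2
    exact hn (hall i hi)
  have hunion : I.valueLaw {v | AllGood σ v}ᶜ ≤ 2⁻¹ := by
    refine (measure_mono hcompl).trans ((measure_iUnion_fintype_le _ _).trans ?_)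
    refine (Finset.sum_le_sum fun x _ => hbad x).trans ?_
    rw [Finset.sum_const, Finset.card_univ, Fintype.card_prod, Fintype.card_coe, nsmul_eq_mul]
    set t := (1 - (p : ℝ≥0∞) ^ L) ^ (Fintype.card K ^ d)
    have hcard : (((nodesBelow L ([] : List K)).card * Fintype.card K : ℕ) : ℝ≥0∞)
        ≤ (Fintype.card K : ℝ≥0∞) ^ (L + 1) := by
      have := card_nodesBelow_le hK L ([] : List K)
      rw [pow_succ]
      exact_mod_cast Nat.mul_le_mul_right _ (by omega)
    have hmul := ENNReal.one_sub_pow_mul_le_one (x := (p : ℝ≥0∞) ^ L) (Fintype.card K ^ d)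
      (pow_le_one₀ zero_le (by exact_mod_cast hp))
    have hcount' : (2 : ℝ≥0∞) * Fintype.card K ^ (L + 1) ≤ Fintype.card K ^ d * (p : ℝ≥0∞) ^ L := by
      exact_mod_cast hcount
    rw [ENNReal.le_inv_iff_mul_le]
    calc _ ≤ (Fintype.card K : ℝ≥0∞) ^ (L + 1) * t * 2 := by gcongr
      _ = t * (2 * Fintype.card K ^ (L + 1)) := by ring
      _ ≤ t * (Fintype.card K ^ d * (p : ℝ≥0∞) ^ L) := by gcongr
      _ ≤ 1 := by push_cast at hmul; exact hmul
  have hone : 1 ≤ I.valueLaw {v | AllGood σ v} + I.valueLaw {v | AllGood σ v}ᶜ := by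
    rw [← measure_univ (μ := I.valueLaw), ← Set.union_compl_self {v | AllGood σ v}]
    exact measure_union_le _ _
  refine ENNReal.le_of_add_le_add_right (a := 2⁻¹) (by simp) ?_
  rw [ENNReal.inv_two_add_inv_two]
  exact hone.trans (by gcongr)

theorem le_expectedOpt_treeInstance (hσ : Function.Injective σ) (hL : L ≠ 0)
    (hcount : (2 : ℝ≥0) * Fintype.card K ^ (L + 1) ≤ Fintype.card K ^ d * p ^ L) :
    (L : ℝ≥0∞) * 2⁻¹ ≤ (treeInstance σ hp).expectedOpt :=
  calc (L : ℝ≥0∞) * 2⁻¹ ≤ L * (treeInstance σ hp).valueLaw {v | AllGood σ v} := by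
        gcongr; exact half_le_measure_allGood hσ hcount
    _ ≤ L * (treeInstance σ hp).valueLaw {v | (L : ℝ≥0∞) ≤ (treeInstance σ hp).hindsightOpt v} := by
        gcongr
        exact fun h => le_hindsightOpt_treeInstance hσ hL h
    _ ≤ _ := mul_meas_ge_le_lintegral (by
        unfold ProphetInstance.hindsightOpt
        fun_prop) _

end Instance

/-! ### Choice of parameters and asymptotics. -/

/-- A finite type with at most `n` elements embeds into `Fin n` compatibly with a given key. -/
theorem exists_injective_fin_lt_of_key_lt {E α : Type*} [Fintype E] [LinearOrder α] {n : ℕ}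
    (hn : Fintype.card E ≤ n) (key : E → α) :
    ∃ σ : E → Fin n, Function.Injective σ ∧ ∀ e e', key e < key e' → σ e < σ e' := by
  let e₀ := Fintype.equivFin E
  let t := Tuple.sort (key ∘ e₀.symm)
  refine ⟨fun e => Fin.castLE hn (t.symm (e₀ e)), ?_, fun e e' h => ?_⟩
  · exact (Fin.castLE_injective hn).comp (t.symm.injective.comp e₀.injective)
  · rw [Fin.castLE_lt_castLE_iff]
    by_contra hle
    have := Tuple.monotone_sort (key ∘ e₀.symm) (not_lt.1 hle)
    simp only [Function.comp_apply, t, Equiv.apply_symm_apply, Equiv.symm_apply_apply] at this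
    exact absurd h (not_lt.2 this)

theorem exists_prophetInstance_of_pow_le {L n : ℕ} (hL : 20 ≤ L) (hn : L ^ (12 * L) ≤ n) :
    ∃ I : ProphetInstance n, ENNReal.ofReal (L / 2) ≤ I.expectedOpt ∧
      ∀ A : OnlineAlgorithm.{u} I, A.expectedValue ≤ ENNReal.ofReal (3 / L) := by
  -- `10 * L ^ 2 < q` leaves room for `2 * (d + 1) * L ≤ q` with `d = 2 * L + 2`, while `q ≤ 20 * L
  -- ^ 2 ≤ L ^ 3` keeps the number of items below `L ^ (12 * L)`.
  obtain ⟨q, hq, hlt, hle⟩ := Nat.exists_prime_lt_and_le_two_mul (10 * L ^ 2) (by positivity)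
  have : Fact q.Prime := ⟨hq⟩
  have hL0 : L ≠ 0 := by omega
  have hLr : (0 : ℝ) < L := by exact_mod_cast Nat.pos_of_ne_zero hL0
  have hcardK : Fintype.card (ZMod q) = q := ZMod.card q
  have hqL3 : q ≤ L ^ 3 := by nlinarith [Nat.mul_le_mul_right (L ^ 2) hL]
  have hLq : L ≤ q := by nlinarith
  have hcard : Fintype.card (TreeItem (ZMod q) (2 * L + 2) L) ≤ n := by
    have hnodes : (nodesBelow L ([] : List (ZMod q))).card ≤ q ^ L := by
      have := card_nodesBelow_le (K := ZMod q) (hcardK.symm ▸ hq.two_le) L []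
      rw [hcardK] at this
      omega
    rw [Fintype.card_prod, Fintype.card_prod, Fintype.card_fun, Fintype.card_coe, hcardK,
      Fintype.card_fin, Fintype.card_fin]
    calc _ ≤ q ^ L * (q ^ (2 * L + 2 + 1) * q) := by gcongr
      _ = q ^ (3 * L + 4) := by ring
      _ ≤ q ^ (4 * L) := Nat.pow_le_pow_right hq.pos (by omega)
      _ ≤ (L ^ 3) ^ (4 * L) := by gcongr
      _ = L ^ (12 * L) := by rw [← pow_mul]; congr 1; ring
      _ ≤ n := hn
  obtain ⟨σ, hσ, hord⟩ := exists_injective_fin_lt_of_key_lt hcard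
    -- The reversed order on depth makes the deepest items arrive first.
    fun e => OrderDual.toDual e.1.1.length
  set p : ℝ≥0 := ((L : ℝ≥0) ^ 2)⁻¹ with hp
  have hL1 : (1 : ℝ≥0) ≤ L := by exact_mod_cast Nat.one_le_iff_ne_zero.2 hL0
  have hp1 : p ≤ 1 := inv_le_one_of_one_le₀ (one_le_pow₀ hL1)
  refine ⟨treeInstance σ hp1, ?_, fun A => ?_⟩
  · refine le_trans (le_of_eq ?_) (le_expectedOpt_treeInstance hσ hL0 ?_)
    · rw [ENNReal.ofReal_div_of_pos two_pos, ENNReal.ofReal_natCast, ENNReal.ofReal_ofNat,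
        div_eq_mul_inv]
    -- Of the exponent `d = 2 * (L + 1)`, one half pays for the union bound and the other for `p ^ L
    -- = L ^ (-2 * L)` and the factor `2`.
    · have hnat : 2 * (L ^ 2) ^ L ≤ q ^ (L + 1) := by
        rw [pow_succ' q]
        exact Nat.mul_le_mul hq.two_le (Nat.pow_le_pow_left (by omega) L)
      have hnn : (2 : ℝ≥0) * ((L : ℝ≥0) ^ 2) ^ L ≤ (q : ℝ≥0) ^ (L + 1) := by exact_mod_cast hnat
      rw [hcardK, hp, inv_pow, ← div_eq_mul_inv, le_div_iff₀ (by positivity)]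
      calc _ = (2 * ((L : ℝ≥0) ^ 2) ^ L) * (q : ℝ≥0) ^ (L + 1) := by ring
        _ ≤ (q : ℝ≥0) ^ (L + 1) * (q : ℝ≥0) ^ (L + 1) := by gcongr
        _ = _ := by ring
  · refine (expectedValue_treeInstance_le hσ (fun e e' h => hord e e' h) ?_ hL0 A).trans
      (le_of_eq ?_)
    · rw [hcardK]
      nlinarith
    · rw [← ENNReal.ofReal_coe_nnreal]
      congr 1
      rw [hp]
      push_cast
      field_simp
      ring

theorem isTheta_floor_div_of_tendsto {f : ℕ → ℝ} (hf : Tendsto f atTop atTop) {c : ℝ} (hc : 0 < c) :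
    (fun n => (⌊f n / c⌋₊ : ℝ)) =Θ[atTop] f := by
  refine ⟨IsBigO.of_bound c⁻¹ ?_, IsBigO.of_bound (2 * c) ?_⟩
  · filter_upwards [hf.eventually_ge_atTop 0] with n hn
    rw [Real.norm_of_nonneg (by positivity), Real.norm_of_nonneg hn, inv_mul_eq_div]
    exact Nat.floor_le (by positivity)
  · filter_upwards [hf.eventually_ge_atTop c] with n hn
    rw [Real.norm_of_nonneg (hc.le.trans hn), Real.norm_of_nonneg (Nat.cast_nonneg _)]
    have h1 := Nat.lt_floor_add_one (f n / c)
    have h2 : (1 : ℝ) ≤ ⌊f n / c⌋₊ := by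
      exact_mod_cast Nat.le_floor (by rw [Nat.cast_one, le_div_iff₀ hc]; linarith)
    rw [div_lt_iff₀ hc] at h1
    nlinarith

theorem tendsto_log_div_log_log :
    Tendsto (fun n : ℕ => Real.log n / Real.log (Real.log n)) atTop atTop := by
  have h : Tendsto (fun x : ℝ => x / Real.log x) atTop atTop := by
    have h0 : Tendsto (fun x : ℝ => Real.log x / x) atTop (nhdsWithin 0 (Set.Ioi 0)) := by
      refine tendsto_nhdsWithin_iff.2 ⟨Real.isLittleO_log_id_atTop.tendsto_div_nhds_zero, ?_⟩
      filter_upwards [eventually_gt_atTop 1] with x hx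
      exact div_pos (Real.log_pos hx) (by linarith)
    exact h0.inv_tendsto_nhdsGT_zero.congr fun x => by simp
  exact h.comp (Real.tendsto_log_atTop.comp tendsto_natCast_atTop_atTop)

/-- Since `L ≤ log n`, one has `12 * L * log L ≤ 12 * L * log (log n) ≤ log n`. -/
theorem floor_log_div_log_log_pow_le {n : ℕ} (hn : 1 ≤ Real.log (Real.log n))
    (hL : 1 ≤ ⌊Real.log n / Real.log (Real.log n) / 12⌋₊) :
    ⌊Real.log n / Real.log (Real.log n) / 12⌋₊
      ^ (12 * ⌊Real.log n / Real.log (Real.log n) / 12⌋₊) ≤ n := by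
  set L := ⌊Real.log n / Real.log (Real.log n) / 12⌋₊ with hLdef
  have hLr : (1 : ℝ) ≤ L := by exact_mod_cast hL
  have hle : (L : ℝ) ≤ Real.log n / Real.log (Real.log n) / 12 :=
    (Nat.le_floor_iff' (by omega)).1 le_rfl
  rw [div_div, le_div_iff₀ (by positivity)] at hle
  have hn0 : (0 : ℝ) < n := by
    rcases Nat.eq_zero_or_pos n with rfl | h
    · norm_num at hn
    · exact_mod_cast h
  have hlog : Real.log L ≤ Real.log (Real.log n) :=
    Real.log_le_log (by linarith) (by nlinarith)
  have : ((L ^ (12 * L) : ℕ) : ℝ) ≤ n := by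
    rw [← Real.log_le_log_iff (by positivity) hn0]
    push_cast
    rw [Real.log_pow]
    push_cast
    nlinarith
  exact_mod_cast this

theorem theorem5 :
    ∃ L : ℕ → ℕ,
      (fun n : ℕ => (L n : ℝ)) =Θ[atTop] (fun n : ℕ => Real.log n / Real.log (Real.log n)) ∧
      ∃ c C κ : ℝ, 0 < c ∧ 0 < C ∧ 0 < κ ∧
        ∀ᶠ n : ℕ in atTop, ∃ I : ProphetInstance n,
          ENNReal.ofReal (c * L n) ≤ I.expectedOpt ∧
          ∀ A : OnlineAlgorithm.{u} I,
            A.expectedValue ≤ ENNReal.ofReal (C / L n) ∧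
            ENNReal.ofReal (κ * (L n : ℝ) ^ 2) * A.expectedValue ≤ I.expectedOpt := by
  refine ⟨fun n => ⌊Real.log n / Real.log (Real.log n) / 12⌋₊,
    isTheta_floor_div_of_tendsto tendsto_log_div_log_log (by norm_num),
    1 / 2, 3, 1 / 6, by norm_num, by norm_num, by norm_num, ?_⟩
  have hloglog : Tendsto (fun n : ℕ => Real.log (Real.log n)) atTop atTop :=
    Real.tendsto_log_atTop.comp (Real.tendsto_log_atTop.comp tendsto_natCast_atTop_atTop)
  have hfloor : Tendsto (fun n : ℕ => ⌊Real.log n / Real.log (Real.log n) / 12⌋₊) atTop atTop :=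
    tendsto_nat_floor_atTop.comp (tendsto_log_div_log_log.atTop_div_const (by norm_num))
  filter_upwards [hloglog.eventually_ge_atTop 1, hfloor.eventually_ge_atTop 20] with n hn hL
  obtain ⟨I, hopt, halg⟩ := exists_prophetInstance_of_pow_le hL
    (floor_log_div_log_log_pow_le hn (by omega))
  set L := ⌊Real.log n / Real.log (Real.log n) / 12⌋₊
  have hLr : (0 : ℝ) < L := by exact_mod_cast (by omega : 0 < L)
  refine ⟨I, by rwa [one_div_mul_eq_div], fun A => ⟨halg A, ?_⟩⟩
  calc _ ≤ ENNReal.ofReal (1 / 6 * (L : ℝ) ^ 2) * ENNReal.ofReal (3 / L) := by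
        gcongr; exact halg A
    _ = ENNReal.ofReal (L / 2) := by
        rw [← ENNReal.ofReal_mul (by positivity)]
        congr 1
        field_simp
        norm_num
    _ ≤ _ := hopt
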